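/- Let $k$ be an arbitrary field (of any characteristic). A formal $2$-form in the variables $(u,v)$ is an expression $\omega=h\,du\wedge dv$ with $h=\sum_j h_j(u)v^j\in k((u))((v))$, and its $(u,v)$-$2$-residue is the coefficient $h_{-1,-1}$ of $u^{-1}v^{-1}$ in $h$ (the residue at $u=0$ of the $1$-residue $h_{-1}(u)\,du$). Let $$u=f(x,y),\qquad v=g(x,y),\qquad\qquad (\mathrm{CV})$$ be a change of variables with $f,g\in k((x))[[y]]$, $f(x,0)\in xk[[x]]\smallsetminus x^2k[[x]]$ and $g\in yk((x))[[y]]\smallsetminus y^2k((x))[[y]]$. Then the substituted series $h(f,g)=\sum_j h_j(f)\,g^j\in k((x))((y))$ is well defined (each $h_j(f)=\sum_i h_{i,j}f^i$ converges in $k((x))[[y]]$ coefficientwise in $y$ for the $x$-adic topology of $k((x))$, and the sum over $j$ converges $y$-adically), so that $\omega$ has a unique expression $$\omega=h(f,g)\,df\wedge dg=h(f,g)\left(\frac{\partial f}{\partial x}\frac{\partial g}{\partial y}-\frac{\partial f}{\partial y}\frac{\partial g}{\partial x}\right)dx\wedge dy$$ in the variables $(x,y)$, and the $(x,y)$-$2$-residue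 of $\omega$, i.e. the coefficient of $x^{-1}y^{-1}$ in $h(f,g)\left(\frac{\partial f}{\partial x}\frac{\partial g}{\partial y}-\frac{\partial f}{\partial y}\frac{\partial g}{\partial x}\right)$, equals the $(u,v)$-$2$-residue of $\omega$. -/

import Mathlib

open scoped LaurentSeries PowerSeries

noncomputable section

namespace FormalResidue

variable {k : Type*} [Field k]

/-- The field `k((u))((v))` of iterated Laurent series `∑ j, h_j(u) v ^ j` with `h_j ∈ k((u))`.
The outer variable is the second one. -/
abbrev Iter (k : Type*) [Field k] : Type _ := k⸨X⸩⸨X⸩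

/-- A formal `2`-form `h du ∧ dv` with `h ∈ k((u))((v))`, in the ordered pair of variables
`(u, v)`; it is recorded by the function `h`. -/
@[ext]
structure TwoForm (k : Type*) [Field k] where
  /-- The function `h` in `h du ∧ dv`. -/
  fn : Iter k

/-- The `1`-residue of `h du ∧ dv` is `h_{-1}(u) du`; it is recorded by the series `h_{-1}`. -/
def TwoForm.oneResidue (ω : TwoForm k) : k⸨X⸩ := ω.fn.coeff (-1)

/-- The `2`-residue of `h du ∧ dv`: the residue at `u = 0` of its `1`-residue, that is, the
coefficient of `u⁻¹ v⁻¹` in `h`. -/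
def TwoForm.twoResidue (ω : TwoForm k) : k := ω.oneResidue.coeff (-1)

/-- The partial derivative of an iterated Laurent series in the first (inner) variable. -/
def dFst (F : Iter k) : Iter k := F.map (LaurentSeries.derivative k : k⸨X⸩ →ₗ[k] k⸨X⸩)

/-- The partial derivative of an iterated Laurent series in the second (outer) variable. -/
def dSnd (F : Iter k) : Iter k := LaurentSeries.derivative k⸨X⸩ F

/-- The function `J` with `dF ∧ dG = J dx ∧ dy`. -/
def jacobian (F G : Iter k) : Iter k := dFst F * dSnd G - dSnd F * dFst G

/-- A change of variables `u = f(x, y)`, `v = g(x, y)` with `f, g ∈ k((x))[[y]]`,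
`f(x, 0) ∈ x k[[x]] ∖ x² k[[x]]` and `g ∈ y k((x))[[y]] ∖ y² k((x))[[y]]`. -/
structure IsChangeOfVariables (f g : k⸨X⸩⟦X⟧) : Prop where
  f_mem : ∃ p : k⟦X⟧, (p : k⸨X⸩) = PowerSeries.constantCoeff f ∧
    PowerSeries.X ∣ p ∧ ¬ PowerSeries.X ^ 2 ∣ p
  g_mem : PowerSeries.X ∣ g ∧ ¬ PowerSeries.X ^ 2 ∣ g

/-- `F = φ(f) = ∑ i, φ_i f ^ i` in `k((x))[[y]]`, for `φ ∈ k((u))`. The series converges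
coefficientwise in `y`, each coefficient for the `x`-adic topology of `k((x))`. -/
def HasSubstFst (f : k⸨X⸩⟦X⟧) (φ : k⸨X⸩) (F : k⸨X⸩⟦X⟧) : Prop :=
  ∀ n : ℕ, HasSum (fun i : ℤ => φ.coeff i • ((f : Iter k) ^ i).coeff (n : ℤ))
    (PowerSeries.coeff n F)

/-- `H = h(f, g) = ∑ j, h_j(f) g ^ j` in `k((x))((y))`, for `h = ∑ j, h_j(u) v ^ j` in
`k((u))((v))`. The series over `j` converges for the `y`-adic topology. -/
def HasSubst (f g : k⸨X⸩⟦X⟧) (h H : Iter k) : Prop :=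
  ∃ F : ℤ → k⸨X⸩⟦X⟧, (∀ j, HasSubstFst f (h.coeff j) (F j)) ∧
    HasSum (fun j : ℤ => (F j : Iter k) * (g : Iter k) ^ j) H

/-- `η` is the expression of `ω` in the variables `(x, y)`, where `u = f(x, y)` and
`v = g(x, y)`: if `ω = h du ∧ dv`, then
`η = h(f, g) df ∧ dg = h(f, g) (∂f/∂x ∂g/∂y - ∂f/∂y ∂g/∂x) dx ∧ dy`. -/
def TwoForm.IsPullback (f g : k⸨X⸩⟦X⟧) (ω η : TwoForm k) : Prop :=
  ∃ H : Iter k, HasSubst f g ω.fn H ∧ η.fn = H * jacobian (f : Iter k) (g : Iter k)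

end FormalResidue

end

noncomputable section

universe u

namespace FormalResidue

/-! ### Derivations and residues over a commutative ring -/

section CommRing

variable {A : Type*} [CommRing A]

/-! The residue passes through the two convergent sums defining `h(f, g)`, so everything reduces to
monomials: the residue of `f^i g^j df ∧ dg` must be `1` for `i = j = -1` and `0` otherwise. If `j ≠
-1`, then `(j + 1) f^i g^j df ∧ dg` is exact, and exact forms have residue zero; the case `i ≠ -1`
is symmetric. Dividing by `j + 1` may fail in characteristic `p`, so `f` and `g` are first lifted to
units over a characteristic zero domain mapping to `k`, where the vanishing is proved and then
pushed down (`residue_zpow_mul_jac`). For `i = j = -1`, writing `g = y b` shows that the 1-residue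
is the logarithmic derivative of `f(x, 0)`, a series of order one (`residue_inv_mul_inv_mul_jac`).
-/

theorem exists_coeff_eq_zero_of_lt (x : A⸨X⸩) : ∃ a : ℤ, ∀ i < a, x.coeff i = 0 :=
  ⟨x.order, fun _ h => HahnSeries.coeff_eq_zero_of_lt_order h⟩

/-- The range of summation depends only on lower bounds for the supports, so products of a series
and of its derivatives can be compared term by term. -/
theorem coeff_mul_eq_sum_Icc {x y : A⸨X⸩} {a b : ℤ} (hx : ∀ i < a, x.coeff i = 0)
    (hy : ∀ i < b, y.coeff i = 0) (n : ℤ) :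
    (x * y).coeff n = ∑ i ∈ Finset.Icc a (n - b), x.coeff i * y.coeff (n - i) := by
  rw [HahnSeries.coeff_mul]
  refine Finset.sum_of_injOn Prod.fst ?_ ?_ ?_ ?_
  · rintro ⟨i, j⟩ hp ⟨i', j'⟩ hp' h
    simp only [Finset.mem_coe, Finset.mem_antidiagonal] at hp hp'
    simp only at h
    ext <;> simp <;> omega
  · rintro ⟨i, j⟩ hp
    simp only [Finset.mem_coe, Finset.mem_antidiagonal, HahnSeries.mem_support] at hp
    have h1 : a ≤ i := le_of_not_gt fun h => hp.1 (hx i h)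
    have h2 : b ≤ j := le_of_not_gt fun h => hp.2.1 (hy j h)
    simp only [Finset.coe_Icc, Set.mem_Icc]
    omega
  · intro i _ hi
    by_contra h
    refine hi ⟨(i, n - i), ?_, rfl⟩
    simp only [Finset.mem_coe, Finset.mem_antidiagonal, HahnSeries.mem_support]
    exact ⟨left_ne_zero_of_mul h, right_ne_zero_of_mul h, by omega⟩
  · rintro ⟨i, j⟩ hp
    simp only [Finset.mem_antidiagonal] at hp
    rw [← hp.2.2]
    simp

theorem coeff_derivative (x : A⸨X⸩) (n : ℤ) :
    (LaurentSeries.derivative A x).coeff n = (n + 1) • x.coeff (n + 1) := by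
  simp

theorem derivative_mul (x y : A⸨X⸩) :
    LaurentSeries.derivative A (x * y) =
      LaurentSeries.derivative A x * y + x * LaurentSeries.derivative A y := by
  obtain ⟨a, ha⟩ := exists_coeff_eq_zero_of_lt x
  obtain ⟨b, hb⟩ := exists_coeff_eq_zero_of_lt y
  have ha' : ∀ i < a - 1, (LaurentSeries.derivative A x).coeff i = 0 := fun i hi => by
    rw [coeff_derivative, ha _ (by omega), smul_zero]
  have hb' : ∀ i < b - 1, (LaurentSeries.derivative A y).coeff i = 0 := fun i hi => by
    rw [coeff_derivative, hb _ (by omega), smul_zero]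
  ext n
  have key : ∑ i ∈ Finset.Icc (a - 1) (n - b),
      (LaurentSeries.derivative A x).coeff i * y.coeff (n - i) =
      ∑ i ∈ Finset.Icc a (n + 1 - b), (i • x.coeff i) * y.coeff (n + 1 - i) := by
    refine Finset.sum_nbij' (fun i => i + 1) (fun i => i - 1) ?_ ?_ ?_ ?_ ?_
    · intro i; simp only [Finset.mem_Icc]; omega
    · intro i; simp only [Finset.mem_Icc]; omega
    · intro i _; simp
    · intro i _; simp
    · intro i _
      rw [coeff_derivative]
      congr 2
      omega
  rw [HahnSeries.coeff_add, coeff_derivative, coeff_mul_eq_sum_Icc ha hb,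
    coeff_mul_eq_sum_Icc ha' hb, coeff_mul_eq_sum_Icc ha hb', key,
    show n - (b - 1) = n + 1 - b by ring, ← Finset.sum_add_distrib, Finset.smul_sum]
  refine Finset.sum_congr rfl fun i _ => ?_
  rw [coeff_derivative, show n - i + 1 = n + 1 - i by ring]
  simp only [zsmul_eq_mul]
  push_cast
  ring

theorem coeff_neg_one_derivative (x : A⸨X⸩) :
    (LaurentSeries.derivative A x).coeff (-1) = 0 := by
  rw [coeff_derivative]
  simp

/-- The partial derivative of an iterated Laurent series in the inner variable, over any
commutative ring. -/
def innerDeriv (A : Type*) [CommRing A] : A⸨X⸩⸨X⸩ →+ A⸨X⸩⸨X⸩ where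
  toFun F := F.map (LaurentSeries.derivative A : A⸨X⸩ →ₗ[A] A⸨X⸩)
  map_zero' := by ext; simp
  map_add' F G := by ext; simp

/-- The partial derivative of an iterated Laurent series in the outer variable, over any
commutative ring. -/
def outerDeriv (A : Type*) [CommRing A] : A⸨X⸩⸨X⸩ →+ A⸨X⸩⸨X⸩ :=
  (LaurentSeries.derivative A⸨X⸩ : A⸨X⸩⸨X⸩ →ₗ[A⸨X⸩] A⸨X⸩⸨X⸩).toAddMonoidHom

/-- The coefficient of the product of the inverses of both variables. -/
def residue (A : Type*) [CommRing A] : A⸨X⸩⸨X⸩ →+ A where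
  toFun F := (F.coeff (-1)).coeff (-1)
  map_zero' := by simp
  map_add' F G := by simp

theorem coeff_innerDeriv (F : A⸨X⸩⸨X⸩) (n : ℤ) :
    (innerDeriv A F).coeff n = LaurentSeries.derivative A (F.coeff n) := rfl

theorem coeff_outerDeriv (F : A⸨X⸩⸨X⸩) (n : ℤ) :
    (outerDeriv A F).coeff n = (n + 1) • F.coeff (n + 1) :=
  coeff_derivative F n

theorem residue_apply (F : A⸨X⸩⸨X⸩) : residue A F = (F.coeff (-1)).coeff (-1) := rfl

theorem innerDeriv_mul (F G : A⸨X⸩⸨X⸩) :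
    innerDeriv A (F * G) = innerDeriv A F * G + F * innerDeriv A G := by
  obtain ⟨a, ha⟩ := exists_coeff_eq_zero_of_lt F
  obtain ⟨b, hb⟩ := exists_coeff_eq_zero_of_lt G
  have ha' : ∀ i < a, (innerDeriv A F).coeff i = 0 := fun i hi => by
    rw [coeff_innerDeriv, ha i hi, map_zero]
  have hb' : ∀ i < b, (innerDeriv A G).coeff i = 0 := fun i hi => by
    rw [coeff_innerDeriv, hb i hi, map_zero]
  refine HahnSeries.ext (funext fun n => ?_)
  rw [HahnSeries.coeff_add, coeff_innerDeriv, coeff_mul_eq_sum_Icc ha hb,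
    coeff_mul_eq_sum_Icc ha' hb, coeff_mul_eq_sum_Icc ha hb', ← Finset.sum_add_distrib, map_sum]
  exact Finset.sum_congr rfl fun i _ => derivative_mul _ _

theorem outerDeriv_mul (F G : A⸨X⸩⸨X⸩) :
    outerDeriv A (F * G) = outerDeriv A F * G + F * outerDeriv A G :=
  derivative_mul F G

theorem innerDeriv_outerDeriv (F : A⸨X⸩⸨X⸩) :
    innerDeriv A (outerDeriv A F) = outerDeriv A (innerDeriv A F) := by
  refine HahnSeries.ext (funext fun n => ?_)
  rw [coeff_innerDeriv, coeff_outerDeriv, coeff_outerDeriv, coeff_innerDeriv, map_zsmul]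

theorem residue_innerDeriv (F : A⸨X⸩⸨X⸩) : residue A (innerDeriv A F) = 0 :=
  coeff_neg_one_derivative (F.coeff (-1))

theorem residue_outerDeriv (F : A⸨X⸩⸨X⸩) : residue A (outerDeriv A F) = 0 := by
  rw [residue_apply, coeff_outerDeriv]
  simp

/-- The function `J` with `dF ∧ dG = J dx ∧ dy`, over any commutative ring. -/
def jac (F G : A⸨X⸩⸨X⸩) : A⸨X⸩⸨X⸩ :=
  innerDeriv A F * outerDeriv A G - outerDeriv A F * innerDeriv A G

theorem jac_swap (F G : A⸨X⸩⸨X⸩) : jac G F = -jac F G := by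
  unfold jac
  ring

end CommRing

/-! ### Exactness of monomial forms -/

section Exact

variable {R : Type*} [CommRing R]

theorem leibniz_units_zpow (d : R →+ R) (hd : ∀ x y, d (x * y) = d x * y + x * d y) (u : Rˣ)
    (n : ℤ) : d ((u ^ n : Rˣ) : R) = n * ((u ^ (n - 1) : Rˣ) : R) * d u := by
  have step : ∀ m : ℤ, ((u ^ m : Rˣ) : R) = ((u ^ (m - 1) : Rˣ) : R) * u := fun m => by
    rw [← Units.val_mul, zpow_sub_one, inv_mul_cancel_right]
  have h1 : d 1 = 0 := by simpa using hd 1 1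
  induction n using Int.induction_on with
  | zero => simp [h1]
  | succ n ih =>
    rw [step (n + 1), add_sub_cancel_right, hd, ih, step n]
    push_cast
    ring
  | pred n ih =>
    have h := hd ((u ^ (-(n : ℤ) - 1) : Rˣ) : R) u
    rw [← step, ih] at h
    refine u.isUnit.mul_right_cancel ?_
    rw [eq_sub_of_add_eq h.symm, step (-(n : ℤ) - 1)]
    push_cast
    ring

/-- This is `(j + 1) u^i v^j du ∧ dv = -d(u^i v^(j+1) du)`; the second derivatives of `u` cancel
because `d` and `e` commute. -/
theorem zsmul_units_zpow_mul_eq_exact (d e : R →+ R)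
    (hd : ∀ x y, d (x * y) = d x * y + x * d y) (he : ∀ x y, e (x * y) = e x * y + x * e y)
    (hde : ∀ x, d (e x) = e (d x)) (u v : Rˣ) (i j : ℤ) :
    (j + 1) • (((u ^ i : Rˣ) : R) * ((v ^ j : Rˣ) : R) * (d u * e v - e u * d v)) =
      e (((u ^ i : Rˣ) : R) * d u * ((v ^ (j + 1) : Rˣ) : R)) -
        d (((u ^ i : Rˣ) : R) * e u * ((v ^ (j + 1) : Rˣ) : R)) := by
  simp only [hd, he, leibniz_units_zpow d hd, leibniz_units_zpow e he, hde,
    add_sub_cancel_right, zsmul_eq_mul]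
  push_cast
  ring

end Exact

/-! ### Vanishing of residues in characteristic zero -/

section TorsionFree

variable {A : Type*} [CommRing A] [IsDomain A] [CharZero A]

theorem residue_units_zpow_mul_jac_aux (u v : A⸨X⸩⸨X⸩ˣ) (i : ℤ) {j : ℤ} (hj : j ≠ -1) :
    residue A (((u ^ i : A⸨X⸩⸨X⸩ˣ) : A⸨X⸩⸨X⸩) * ((v ^ j : A⸨X⸩⸨X⸩ˣ) : A⸨X⸩⸨X⸩) *
      jac (u : A⸨X⸩⸨X⸩) v) = 0 := by
  have h := congrArg (residue A) (zsmul_units_zpow_mul_eq_exact (innerDeriv A) (outerDeriv A)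
    innerDeriv_mul outerDeriv_mul innerDeriv_outerDeriv u v i j)
  rw [map_sub, residue_outerDeriv, residue_innerDeriv, sub_zero, map_zsmul, zsmul_eq_mul,
    mul_eq_zero, Int.cast_eq_zero] at h
  exact h.resolve_left (by omega)

theorem residue_units_zpow_mul_jac (u v : A⸨X⸩⸨X⸩ˣ) {i j : ℤ} (hij : ¬(i = -1 ∧ j = -1)) :
    residue A (((u ^ i : A⸨X⸩⸨X⸩ˣ) : A⸨X⸩⸨X⸩) * ((v ^ j : A⸨X⸩⸨X⸩ˣ) : A⸨X⸩⸨X⸩) *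
      jac (u : A⸨X⸩⸨X⸩) v) = 0 := by
  by_cases hj : j = -1
  · have h := residue_units_zpow_mul_jac_aux v u j (j := i) (by tauto)
    rw [← neg_eq_zero, ← map_neg, ← h, jac_swap (u : A⸨X⸩⸨X⸩)]
    congr 1
    ring
  · exact residue_units_zpow_mul_jac_aux u v i hj

end TorsionFree

/-! ### Lifting to characteristic zero -/

section Lift

variable {A B : Type*} [CommRing A] [CommRing B]

/-- The ring homomorphism on Laurent series given by a ring homomorphism of coefficients. -/
def mapLaurent (φ : A →+* B) : A⸨X⸩ →+* B⸨X⸩ where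
  toFun x := x.map φ
  map_zero' := by ext; simp
  map_one' := HahnSeries.map_one φ.toMonoidWithZeroHom
  map_add' x y := by ext; simp
  map_mul' x y := HahnSeries.map_mul (φ : A →ₙ+* B)

theorem coeff_mapLaurent (φ : A →+* B) (x : A⸨X⸩) (n : ℤ) :
    (mapLaurent φ x).coeff n = φ (x.coeff n) := rfl

theorem derivative_mapLaurent (φ : A →+* B) (x : A⸨X⸩) :
    LaurentSeries.derivative B (mapLaurent φ x) = mapLaurent φ (LaurentSeries.derivative A x) := by
  ext n
  rw [coeff_derivative, coeff_mapLaurent, coeff_mapLaurent, coeff_derivative, map_zsmul]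

theorem mapLaurent_jac (φ : A →+* B) (F G : A⸨X⸩⸨X⸩) :
    mapLaurent (mapLaurent φ) (jac F G) =
      jac (mapLaurent (mapLaurent φ) F) (mapLaurent (mapLaurent φ) G) := by
  have h1 : ∀ F : A⸨X⸩⸨X⸩, innerDeriv B (mapLaurent (mapLaurent φ) F) =
      mapLaurent (mapLaurent φ) (innerDeriv A F) := fun F =>
    HahnSeries.ext (funext fun n => derivative_mapLaurent φ (F.coeff n))
  have h2 : ∀ F : A⸨X⸩⸨X⸩, outerDeriv B (mapLaurent (mapLaurent φ) F) =
      mapLaurent (mapLaurent φ) (outerDeriv A F) := fun F => derivative_mapLaurent (mapLaurent φ) F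
  simp only [jac, map_sub, map_mul, h1, h2]

theorem residue_mapLaurent (φ : A →+* B) (F : A⸨X⸩⸨X⸩) :
    residue B (mapLaurent (mapLaurent φ) F) = φ (residue A F) := rfl

/-- Over a domain a Laurent series with unit leading coefficient is a unit. The conclusion has the
shape of `hφ`, so the lemma can be iterated for the two variables. -/
theorem exists_isUnit_mapLaurent_eq [IsDomain A] (φ : A →+* B)
    (hφ : ∀ b ≠ 0, ∃ a, IsUnit a ∧ φ a = b) (y : B⸨X⸩) (hy : y ≠ 0) :
    ∃ x, IsUnit x ∧ mapLaurent φ x = y := by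
  classical
  choose! s hs using hφ
  -- Sending `0` to `0` preserves the support, hence the order, so the leading coefficient is lifted
  -- to a unit.
  let t : ZeroHom B A := ⟨fun b => if b = 0 then 0 else s b, by simp⟩
  have ht0 : ∀ b, t b = if b = 0 then 0 else s b := fun _ => rfl
  have hφt : ∀ b, φ (t b) = b := fun b => by
    by_cases hb : b = 0
    · simp [ht0, hb]
    · simp [ht0, hb, (hs b hb).2]
  have hxy : mapLaurent φ (y.map t) = y := by
    ext n
    rw [coeff_mapLaurent, HahnSeries.map_coeff, hφt]
  have hsupp : ∀ n, (y.map t).coeff n = 0 ↔ y.coeff n = 0 := fun n => by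
    rw [HahnSeries.map_coeff]
    exact ⟨fun h => by rw [← hφt (y.coeff n), h, map_zero], fun h => by rw [h, map_zero]⟩
  have hx : y.map t ≠ 0 := fun h => hy (by rw [← hxy, h, map_zero])
  have hord : (y.map t).order = y.order := by
    refine le_antisymm (HahnSeries.order_le_of_coeff_ne_zero fun h => ?_)
      (HahnSeries.order_le_of_coeff_ne_zero fun h => ?_)
    · exact hy (HahnSeries.coeff_order_eq_zero.1 ((hsupp _).1 h))
    · exact hx (HahnSeries.coeff_order_eq_zero.1 ((hsupp _).2 h))
  refine ⟨y.map t, HahnSeries.isUnit_iff.2 ?_, hxy⟩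
  have hlc : y.coeff y.order ≠ 0 := fun h => hy (HahnSeries.coeff_order_eq_zero.1 h)
  rw [HahnSeries.leadingCoeff_eq, hord, HahnSeries.map_coeff, ht0, if_neg hlc]
  exact (hs _ hlc).1

/-- Every field is the residue field of a local domain of characteristic zero. -/
theorem exists_charZero_domain_lift (k : Type u) [Field k] :
    ∃ (A : Type u) (_ : CommRing A) (_ : IsDomain A) (_ : CharZero A) (φ : A →+* k),
      ∀ b ≠ 0, ∃ a, IsUnit a ∧ φ a = b := by
  -- Take `ℤ[X_b : b ∈ k]` with `X_b ↦ b`, localized at the kernel: for `b ≠ 0` the variable `X_b`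
  -- lies outside the kernel and becomes a unit.
  let ψ : MvPolynomial k ℤ →+* k := MvPolynomial.eval₂Hom (Int.castRingHom k) id
  have : (RingHom.ker ψ).IsPrime := RingHom.ker_isPrime ψ
  let S := (RingHom.ker ψ).primeCompl
  have hS : S ≤ nonZeroDivisors (MvPolynomial k ℤ) :=
    Ideal.primeCompl_le_nonZeroDivisors _
  have hu : ∀ y : S, IsUnit (ψ y) := fun y => IsUnit.mk0 _ fun h => y.2 h
  refine ⟨Localization S, inferInstance, IsLocalization.isDomain_localization hS,
    charZero_of_injective_algebraMap (R := MvPolynomial k ℤ) (IsLocalization.injective _ hS),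
    IsLocalization.lift hu, fun b hb => 
      ⟨algebraMap (MvPolynomial k ℤ) (Localization S) (MvPolynomial.X b), ?_, ?_⟩⟩
  · refine IsLocalization.map_units (Localization S) (⟨MvPolynomial.X b, fun h => hb ?_⟩ : S)
    simpa [ψ] using h
  · rw [IsLocalization.lift_eq]
    simp [ψ]

end Lift

section Field

variable {k : Type*} [Field k]

theorem residue_zpow_mul_jac {f g : k⸨X⸩⸨X⸩} (hf : f ≠ 0) (hg : g ≠ 0) {i j : ℤ}
    (hij : ¬(i = -1 ∧ j = -1)) : residue k (f ^ i * g ^ j * jac f g) = 0 := by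
  obtain ⟨A, _, _, _, φ, hφ⟩ := exists_charZero_domain_lift k
  have hφ' := exists_isUnit_mapLaurent_eq _ (exists_isUnit_mapLaurent_eq φ hφ)
  obtain ⟨_, ⟨u, rfl⟩, hu⟩ := hφ' f hf
  obtain ⟨_, ⟨v, rfl⟩, hv⟩ := hφ' g hg
  have hz : ∀ (w : A⸨X⸩⸨X⸩ˣ) (n : ℤ), mapLaurent (mapLaurent φ) ((w ^ n : A⸨X⸩⸨X⸩ˣ) : A⸨X⸩⸨X⸩) =
      mapLaurent (mapLaurent φ) (w : A⸨X⸩⸨X⸩) ^ n := fun w n => by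
    have := congrArg Units.val
      (map_zpow (Units.map (mapLaurent (mapLaurent φ)).toMonoidHom) w n)
    rw [Units.val_zpow_eq_zpow_val] at this
    exact this
  rw [← hu, ← hv, ← hz, ← hz, ← mapLaurent_jac, ← map_mul, ← map_mul, residue_mapLaurent,
    residue_units_zpow_mul_jac u v hij, map_zero]

end Field

/-! ### The logarithmic form `df/f ∧ dg/g` -/

section LogResidue

variable {K : Type*} [Field K]

theorem exists_eq_X_mul {p : K⟦X⟧} (h1 : PowerSeries.X ∣ p) (h2 : ¬PowerSeries.X ^ 2 ∣ p) :
    ∃ q : K⟦X⟧, p = PowerSeries.X * q ∧ PowerSeries.constantCoeff q ≠ 0 := by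
  obtain ⟨q, rfl⟩ := h1
  refine ⟨q, rfl, fun h => h2 ?_⟩
  rw [pow_two]
  exact mul_dvd_mul_left _ (PowerSeries.X_dvd_iff.2 h)

theorem coe_ne_zero {p : K⟦X⟧} (hp : p ≠ 0) : (p : K⸨X⸩) ≠ 0 := fun h =>
  hp (HahnSeries.ofPowerSeries_injective (by rw [h, map_zero]))

theorem coe_inv {p : K⟦X⟧} (hp : PowerSeries.constantCoeff p ≠ 0) :
    ((p⁻¹ : K⟦X⟧) : K⸨X⸩) = (p : K⸨X⸩)⁻¹ := by
  refine eq_inv_of_mul_eq_one_left ?_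
  rw [← map_mul, PowerSeries.inv_mul_cancel _ hp, map_one]

theorem mem_range_coe_iff (x : K⸨X⸩) :
    x ∈ (HahnSeries.ofPowerSeries ℤ K).range ↔ ∀ i < 0, x.coeff i = 0 := by
  rw [RingHom.mem_range, ← LaurentSeries.val_le_one_iff_eq_coe,
    ← LaurentSeries.valuation_le_iff_coeff_lt_eq_zero K]
  simp

theorem coe_coeff_of_neg (p : K⟦X⟧) {i : ℤ} (hi : i < 0) : (p : K⸨X⸩).coeff i = 0 :=
  (mem_range_coe_iff _).1 ⟨p, rfl⟩ i hi

theorem coe_derivative_mem_range (p : K⟦X⟧) :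
    LaurentSeries.derivative K (p : K⸨X⸩) ∈ (HahnSeries.ofPowerSeries ℤ K).range := by
  rw [mem_range_coe_iff]
  intro i hi
  rw [coeff_derivative]
  rcases (Int.add_one_le_iff.2 hi).eq_or_lt with h | h
  · rw [h, zero_smul]
  · rw [coe_coeff_of_neg p h, smul_zero]

theorem coe_innerDeriv_mem_range (p : K⸨X⸩⟦X⟧) :
    innerDeriv K (p : K⸨X⸩⸨X⸩) ∈ (HahnSeries.ofPowerSeries ℤ K⸨X⸩).range := by
  rw [mem_range_coe_iff]
  intro i hi
  rw [coeff_innerDeriv, coe_coeff_of_neg p hi, map_zero]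

theorem coe_outerDeriv_mem_range (p : K⸨X⸩⟦X⟧) :
    outerDeriv K (p : K⸨X⸩⸨X⸩) ∈ (HahnSeries.ofPowerSeries ℤ K⸨X⸩).range :=
  coe_derivative_mem_range p

theorem single_one_mul_single_neg_one :
    (HahnSeries.single (1 : ℤ) (1 : K)) * HahnSeries.single (-1 : ℤ) (1 : K) = 1 := by
  rw [HahnSeries.single_mul_single]
  simp

theorem derivative_single_one :
    LaurentSeries.derivative K (HahnSeries.single (1 : ℤ) (1 : K)) = 1 := by
  simp

/-- The logarithmic derivative of a series of order one has residue one. -/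
theorem coeff_inv_mul_derivative {p : K⟦X⟧} (h1 : PowerSeries.X ∣ p)
    (h2 : ¬PowerSeries.X ^ 2 ∣ p) :
    ((p : K⸨X⸩)⁻¹ * LaurentSeries.derivative K (p : K⸨X⸩)).coeff (-1) = 1 := by
  obtain ⟨q, rfl, hq⟩ := exists_eq_X_mul h1 h2
  have hq0 : (q : K⸨X⸩) ≠ 0 := coe_ne_zero fun h => hq (by rw [h, map_zero])
  have ht := single_one_mul_single_neg_one (K := K)
  rw [map_mul, HahnSeries.ofPowerSeries_X, derivative_mul, derivative_single_one, mul_inv,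
    inv_eq_of_mul_eq_one_right ht]
  have : (HahnSeries.single (-1 : ℤ) (1 : K)) * (q : K⸨X⸩)⁻¹ *
      (1 * (q : K⸨X⸩) + HahnSeries.single 1 1 * LaurentSeries.derivative K (q : K⸨X⸩)) =
      HahnSeries.single (-1 : ℤ) (1 : K) +
        (q : K⸨X⸩)⁻¹ * LaurentSeries.derivative K (q : K⸨X⸩) := by
    linear_combination (HahnSeries.single (-1 : ℤ) (1 : K)) * inv_mul_cancel₀ hq0 +
      (q : K⸨X⸩)⁻¹ * LaurentSeries.derivative K (q : K⸨X⸩) * ht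
  rw [this, HahnSeries.coeff_add, HahnSeries.coeff_single_same, ← coe_inv hq,
    (mem_range_coe_iff _).1 (mul_mem ⟨_, rfl⟩ (coe_derivative_mem_range q)) (-1) (by norm_num),
    add_zero]

variable {k : Type*} [Field k]

theorem residue_inv_mul_inv_mul_jac {f g : k⸨X⸩⟦X⟧} (hfg : IsChangeOfVariables f g) :
    residue k ((f : Iter k)⁻¹ * (g : Iter k)⁻¹ * jac (f : Iter k) (g : Iter k)) = 1 := by
  obtain ⟨p, hp, hp1, hp2⟩ := hfg.f_mem
  obtain ⟨b, rfl, hb⟩ := exists_eq_X_mul hfg.g_mem.1 hfg.g_mem.2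
  have hf0 : PowerSeries.constantCoeff f ≠ 0 := by
    rw [← hp]
    exact coe_ne_zero fun h => hp2 (by rw [h]; exact dvd_zero _)
  have hb0 : (b : Iter k) ≠ 0 := coe_ne_zero fun h => hb (by rw [h, map_zero])
  have ht := single_one_mul_single_neg_one (K := k⸨X⸩)
  have hti : innerDeriv k (HahnSeries.single (1 : ℤ) (1 : k⸨X⸩)) = 0 := by
    refine HahnSeries.ext (funext fun n => ?_)
    rw [coeff_innerDeriv, HahnSeries.coeff_single]
    split_ifs
    · ext m
      rw [coeff_derivative, HahnSeries.coeff_one]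
      split_ifs with h
      · simp [h]
      · simp
    · simp
  have hto : outerDeriv k (HahnSeries.single (1 : ℤ) (1 : k⸨X⸩)) = 1 :=
    derivative_single_one
  rw [map_mul (HahnSeries.ofPowerSeries ℤ k⸨X⸩), HahnSeries.ofPowerSeries_X, jac, innerDeriv_mul, outerDeriv_mul, hti, hto,
    mul_inv, inv_eq_of_mul_eq_one_right ht]
  -- With `g = y b`, the form splits as `f⁻¹ f_x y⁻¹` plus a term without negative powers of `y`.
  have hJ : (f : Iter k)⁻¹ * (HahnSeries.single (-1 : ℤ) (1 : k⸨X⸩) * (b : Iter k)⁻¹) *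
      (innerDeriv k (f : Iter k) *
        (1 * (b : Iter k) + HahnSeries.single 1 1 * outerDeriv k (b : Iter k)) -
        outerDeriv k (f : Iter k) * (0 * (b : Iter k) +
          HahnSeries.single 1 1 * innerDeriv k (b : Iter k))) =
      (f : Iter k)⁻¹ * innerDeriv k (f : Iter k) * HahnSeries.single (-1 : ℤ) (1 : k⸨X⸩) +
        (f : Iter k)⁻¹ * (b : Iter k)⁻¹ * (innerDeriv k (f : Iter k) * outerDeriv k (b : Iter k) -
          outerDeriv k (f : Iter k) * innerDeriv k (b : Iter k)) := by
    linear_combination (f : Iter k)⁻¹ * innerDeriv k (f : Iter k) *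
      HahnSeries.single (-1 : ℤ) (1 : k⸨X⸩) * inv_mul_cancel₀ hb0 +
      (f : Iter k)⁻¹ * (b : Iter k)⁻¹ * (innerDeriv k (f : Iter k) * outerDeriv k (b : Iter k) -
          outerDeriv k (f : Iter k) * innerDeriv k (b : Iter k)) * ht
  obtain ⟨f', hf'⟩ := coe_innerDeriv_mem_range f
  have hf'0 : PowerSeries.constantCoeff f' =
      LaurentSeries.derivative k (PowerSeries.constantCoeff f) := by
    have h := congrArg (fun F : Iter k => F.coeff ((0 : ℕ) : ℤ)) hf'
    simp only [coeff_innerDeriv, HahnSeries.ofPowerSeries_apply_coeff] at h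
    simpa using h
  rw [hJ, map_add, ← coe_inv hf0, ← coe_inv hb, residue_apply, residue_apply,
    (mem_range_coe_iff _).1 (mul_mem (mul_mem ⟨_, rfl⟩ ⟨_, rfl⟩)
      (sub_mem (mul_mem (coe_innerDeriv_mem_range f) (coe_outerDeriv_mem_range b))
        (mul_mem (coe_outerDeriv_mem_range f) (coe_innerDeriv_mem_range b)))) (-1) (by norm_num),
    HahnSeries.coeff_zero, add_zero, HahnSeries.coeff_mul_single, mul_one, ← hf', ← map_mul,
    show (-1 - -1 : ℤ) = ((0 : ℕ) : ℤ) by norm_num, HahnSeries.ofPowerSeries_apply_coeff,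
    PowerSeries.coeff_zero_eq_constantCoeff_apply, map_mul, hf'0,
    PowerSeries.constantCoeff_inv, ← hp]
  exact coeff_inv_mul_derivative hp1 hp2

theorem residue_zpow_mul_zpow_mul_jac {f g : k⸨X⸩⟦X⟧} (hfg : IsChangeOfVariables f g) (i j : ℤ) :
    residue k ((f : Iter k) ^ i * (g : Iter k) ^ j * jac (f : Iter k) (g : Iter k)) =
      if i = -1 ∧ j = -1 then 1 else 0 := by
  split_ifs with h
  · rw [h.1, h.2, zpow_neg_one, zpow_neg_one, residue_inv_mul_inv_mul_jac hfg]
  · refine residue_zpow_mul_jac (coe_ne_zero ?_) (coe_ne_zero ?_) h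
    · rintro rfl
      obtain ⟨p, hp, -, hp2⟩ := hfg.f_mem
      refine coe_ne_zero (p := p) (fun h => hp2 (by rw [h]; exact dvd_zero _)) ?_
      rw [hp, map_zero]
    · rintro rfl
      exact hfg.g_mem.2 (dvd_zero _)

end LogResidue

/-! ### Convergence of the substitution and termwise residues -/

section Sums

variable {K : Type*} [Field K]

theorem hasSum_coeff {ι : Type*} {a : ι → K⸨X⸩} {s : K⸨X⸩} (h : HasSum a s) (n : ℤ) :
    (fun i => (a i).coeff n).HasFiniteSupport ∧ s.coeff n = ∑ᶠ i, (a i).coeff n := by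
  -- Coefficients are continuous for the discrete topology on `K`, where a summable family has
  -- finite support.
  let : UniformSpace K := ⊥
  have : DiscreteUniformity K := ⟨rfl⟩
  have hc : Continuous (HahnSeries.coeff.addMonoidHom (Γ := ℤ) (R := K) n) :=
    (LaurentSeries.uniformContinuous_coeff n).continuous
  have hs : HasSum (fun i => (a i).coeff n) (s.coeff n) := h.map _ hc
  have hfin := hs.summable.hasFiniteSupport_of_discreteTopology
  exact ⟨hfin, by rw [← tsum_eq_finsum (L := .unconditional ι) hfin, hs.tsum_eq]⟩

theorem nonarchimedeanAddGroup : NonarchimedeanAddGroup K⸨X⸩ := by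
  have h := (Valuation.subgroups_basis (Valued.v : Valuation K⸨X⸩ _)).nonarchimedean
  exact { (inferInstance : IsTopologicalAddGroup K⸨X⸩) with
    is_nonarchimedean := h.is_nonarchimedean }

theorem summable_of_eventually_coeff_eq_zero {ι : Type*} {a : ι → K⸨X⸩}
    (h : ∀ N : ℤ, ∀ᶠ i in Filter.cofinite, ∀ n < N, (a i).coeff n = 0) : Summable a := by
  have := nonarchimedeanAddGroup (K := K)
  refine NonarchimedeanAddGroup.summable_of_tendsto_cofinite_zero fun U hU => Filter.mem_map.2 ?_
  obtain ⟨γ, hγ⟩ := Valued.mem_nhds_zero.1 hU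
  let δ := MonoidWithZeroHom.ValueGroup₀.embedding γ.1
  have hδ : δ ≠ 0 := by
    simp [δ]
  filter_upwards [h (1 - WithZero.log δ)] with i hi
  refine hγ ?_
  rw [Set.mem_ofPred_eq, Valued.v.restrict_lt_iff_lt_embedding]
  refine ((LaurentSeries.valuation_le_iff_coeff_lt_eq_zero K).2 hi).trans_lt ?_
  rw [← WithZero.lt_log_iff_exp_lt hδ]
  simp

theorem coeff_mul_eq_zero_of_lt {A : Type*} [CommRing A] {x y : A⸨X⸩} {a b : ℤ}
    (hx : ∀ i < a, x.coeff i = 0) (hy : ∀ i < b, y.coeff i = 0) :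
    ∀ n < a + b, (x * y).coeff n = 0 := by
  intro n hn
  rw [coeff_mul_eq_sum_Icc hx hy, Finset.Icc_eq_empty (by omega), Finset.sum_empty]

variable {k : Type*} [Field k]

/-- The constant term of `f` has `x`-order at least `1`, and picking up `y^m` costs at most `C m` in
`x`-order. Hence the coefficient of `y^m` in `f^i` has order at least `i - C m`, for `m ≤ n`. -/
theorem exists_coeff_pow_eq_zero {f : k⸨X⸩⟦X⟧}
    (hf : ∀ t < 1, (PowerSeries.constantCoeff f).coeff t = 0) (n : ℕ) :
    ∃ C : ℤ, ∀ i : ℕ, ∀ t < i - C, (PowerSeries.coeff n (f ^ i)).coeff t = 0 := by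
  choose a ha using fun m => exists_coeff_eq_zero_of_lt (PowerSeries.coeff m f)
  let C : ℤ := ∑ m ∈ Finset.range (n + 1), |1 - a m|
  have hC0 : 0 ≤ C := Finset.sum_nonneg fun _ _ => abs_nonneg _
  have hC : ∀ m ≤ n, ∀ t < 1 - C * m, (PowerSeries.coeff m f).coeff t = 0 := by
    intro m hm t ht
    rcases Nat.eq_zero_or_pos m with rfl | hm0
    · rw [PowerSeries.coeff_zero_eq_constantCoeff_apply]
      exact hf t (by simpa using ht)
    · refine ha m t ?_
      have h1 : |1 - a m| ≤ C := Finset.single_le_sum (f := fun m => |1 - a m|)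
        (fun _ _ => abs_nonneg _) (Finset.mem_range.2 (Nat.lt_succ_of_le hm))
      have h2 : 1 - a m ≤ |1 - a m| := le_abs_self _
      have h3 : C * 1 ≤ C * m := mul_le_mul_of_nonneg_left (by exact_mod_cast hm0) hC0
      linarith
  have key : ∀ i : ℕ, ∀ m ≤ n, ∀ t < (i : ℤ) - C * m,
      (PowerSeries.coeff m (f ^ i)).coeff t = 0 := by
    intro i
    induction i with
    | zero =>
      intro m _ t ht
      rw [pow_zero, PowerSeries.coeff_one]
      split_ifs with h
      · subst h
        rw [HahnSeries.coeff_one, if_neg]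
        simp at ht
        omega
      · simp
    | succ i ih =>
      intro m hm t ht
      rw [pow_succ, PowerSeries.coeff_mul, HahnSeries.coeff_sum]
      refine Finset.sum_eq_zero fun p hp => ?_
      have hp' := Finset.HasAntidiagonal.mem_antidiagonal.1 hp
      refine coeff_mul_eq_zero_of_lt (ih p.1 (by omega)) (hC p.2 (by omega)) t ?_
      rw [← hp'] at ht
      push_cast at ht
      linarith
  exact ⟨C * n, fun i => key i n le_rfl⟩

theorem exists_hasSubstFst {f : k⸨X⸩⟦X⟧}
    (hf : ∀ t < 1, (PowerSeries.constantCoeff f).coeff t = 0) (φ : k⸨X⸩) :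
    ∃ F, HasSubstFst f φ F := by
  obtain ⟨a, ha⟩ := exists_coeff_eq_zero_of_lt φ
  refine ⟨PowerSeries.mk fun n => ∑' i : ℤ, φ.coeff i • ((f : Iter k) ^ i).coeff (n : ℤ),
    fun n => ?_⟩
  rw [PowerSeries.coeff_mk]
  refine (summable_of_eventually_coeff_eq_zero fun N => ?_).hasSum
  obtain ⟨C, hC⟩ := exists_coeff_pow_eq_zero hf n
  refine (Set.finite_Icc a (max (N + C) 0)).subset fun i hi => ?_
  by_contra hmem
  refine hi fun t ht => ?_
  rcases lt_or_ge i a with h | h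
  · rw [ha i h, zero_smul, HahnSeries.coeff_zero]
  · have hi' : N + C < i ∧ 0 < i := max_lt_iff.1 (not_le.1 fun h' => hmem ⟨h, h'⟩)
    lift i to ℕ using hi'.2.le
    rw [HahnSeries.coeff_smul, zpow_natCast, ← map_pow, HahnSeries.ofPowerSeries_apply_coeff,
      hC i t (by omega), smul_zero]

theorem HasSubstFst.unique {f : k⸨X⸩⟦X⟧} {φ : k⸨X⸩} {F G : k⸨X⸩⟦X⟧} (hF : HasSubstFst f φ F)
    (hG : HasSubstFst f φ G) : F = G :=
  PowerSeries.ext fun n => (hF n).unique (hG n)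

theorem hasSubstFst_zero (f : k⸨X⸩⟦X⟧) : HasSubstFst f 0 0 := fun n => by
  simp

theorem exists_hasSubst {f g : k⸨X⸩⟦X⟧}
    (hf : ∀ t < 1, (PowerSeries.constantCoeff f).coeff t = 0) (hg : PowerSeries.X ∣ g)
    (h : Iter k) : ∃ H, HasSubst f g h H := by
  choose F hF using fun j => exists_hasSubstFst hf (h.coeff j)
  obtain ⟨a, ha⟩ := exists_coeff_eq_zero_of_lt h
  suffices hs : Summable fun j : ℤ => (F j : Iter k) * (g : Iter k) ^ j from
    ⟨_, F, hF, hs.hasSum⟩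
  refine summable_of_eventually_coeff_eq_zero fun N => ?_
  refine (Set.finite_Icc a (max N 0)).subset fun j hj => ?_
  by_contra hmem
  refine hj fun t ht => ?_
  rcases lt_or_ge j a with h' | h'
  · have hF0 : F j = 0 := (hF j).unique (by rw [ha j h']; exact hasSubstFst_zero f)
    rw [hF0, map_zero, zero_mul, HahnSeries.coeff_zero]
  · have hj' : N < j ∧ 0 < j := max_lt_iff.1 (not_le.1 fun h'' => hmem ⟨h', h''⟩)
    lift j to ℕ using hj'.2.le
    rw [zpow_natCast, ← map_pow, ← map_mul]
    rcases lt_or_ge t 0 with h0 | h0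
    · exact coe_coeff_of_neg _ h0
    · lift t to ℕ using h0
      rw [HahnSeries.ofPowerSeries_apply_coeff]
      exact PowerSeries.X_pow_dvd_iff.1 ((pow_dvd_pow_of_dvd hg j).mul_left (F j)) t (by omega)

theorem HasSubst.unique {f g : k⸨X⸩⟦X⟧} {h H H' : Iter k} (hH : HasSubst f g h H)
    (hH' : HasSubst f g h H') : H = H' := by
  obtain ⟨F, hF, hs⟩ := hH
  obtain ⟨F', hF', hs'⟩ := hH'
  obtain rfl : F = F' := funext fun j => (hF j).unique (hF' j)
  exact hs.unique hs'

theorem coe_zpow_mem_range {f : K⟦X⟧} (hf : PowerSeries.constantCoeff f ≠ 0) (i : ℤ) :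
    (f : K⸨X⸩) ^ i ∈ (HahnSeries.ofPowerSeries ℤ K).range := by
  cases i with
  | ofNat n => exact ⟨f ^ n, by simp⟩
  | negSucc n => exact ⟨f⁻¹ ^ (n + 1), by rw [map_pow, coe_inv hf, zpow_negSucc, inv_pow]⟩

/-- The sum for `F` converges only coefficientwise in `y`. This suffices: no power `f^i` has a pole
in `y`, so the `y⁻¹` coefficient of a product with `G` involves only finitely many `y`-coefficients.
-/
theorem HasSubstFst.residue_mul {f : k⸨X⸩⟦X⟧} (hf : PowerSeries.constantCoeff f ≠ 0) {φ : k⸨X⸩}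
    {F : k⸨X⸩⟦X⟧} (hF : HasSubstFst f φ F) (G : Iter k) :
    residue k ((F : Iter k) * G) = ∑ᶠ i : ℤ, φ.coeff i * residue k ((f : Iter k) ^ i * G) := by
  obtain ⟨b, hb⟩ := exists_coeff_eq_zero_of_lt G
  have hcoeff : ∀ P ∈ (HahnSeries.ofPowerSeries ℤ k⸨X⸩).range, (P * G).coeff (-1) =
      ∑ m ∈ Finset.Icc 0 (-1 - b), P.coeff m * G.coeff (-1 - m) := fun P hP =>
    coeff_mul_eq_sum_Icc ((mem_range_coe_iff P).1 hP) hb (-1)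
  have hsum : HasSum (fun i : ℤ => φ.coeff i • ((f : Iter k) ^ i * G).coeff (-1))
      (((F : Iter k) * G).coeff (-1)) := by
    have hterm : ∀ i : ℤ, φ.coeff i • ((f : Iter k) ^ i * G).coeff (-1) =
        ∑ m ∈ Finset.Icc 0 (-1 - b),
          (φ.coeff i • ((f : Iter k) ^ i).coeff m) * G.coeff (-1 - m) := fun i => by
      rw [hcoeff _ (coe_zpow_mem_range hf i), Finset.smul_sum]
      refine Finset.sum_congr rfl fun m _ => ?_
      rw [← HahnSeries.C_mul_eq_smul, ← HahnSeries.C_mul_eq_smul, mul_assoc]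
    rw [hcoeff _ ⟨F, rfl⟩, funext hterm]
    refine hasSum_sum fun m hm => ?_
    obtain ⟨n, rfl⟩ := Int.eq_ofNat_of_zero_le (Finset.mem_Icc.1 hm).1
    have hn := (hF n).mul_right (G.coeff (-1 - (n : ℤ)))
    rwa [← HahnSeries.ofPowerSeries_apply_coeff (Γ := ℤ)] at hn
  exact (hasSum_coeff hsum (-1)).2

theorem HasSubst.residue_mul_jac {f g : k⸨X⸩⟦X⟧} (hfg : IsChangeOfVariables f g) {h H : Iter k}
    (hH : HasSubst f g h H) :
    residue k (H * jac (f : Iter k) (g : Iter k)) = residue k h := by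
  have hf0 : PowerSeries.constantCoeff f ≠ 0 := by
    obtain ⟨p, hp, -, hp2⟩ := hfg.f_mem
    rw [← hp]
    exact coe_ne_zero fun h => hp2 (by rw [h]; exact dvd_zero _)
  obtain ⟨F, hF, hs⟩ := hH
  obtain ⟨hfin, hc⟩ := hasSum_coeff (hs.mul_right (jac (f : Iter k) (g : Iter k))) (-1)
  have hres : ∀ j, residue k ((F j : Iter k) * (g : Iter k) ^ j * jac (f : Iter k) (g : Iter k)) =
      if j = -1 then residue k h else 0 := by
    intro j
    -- Expanding in powers of `f` leaves only monomial residues, so at most `i = -1` survives.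
    rw [mul_assoc, (hF j).residue_mul hf0]
    simp only [← mul_assoc, residue_zpow_mul_zpow_mul_jac hfg]
    rw [finsum_eq_single _ (-1) fun i hi => by rw [if_neg fun h => hi h.1, mul_zero]]
    by_cases hj : j = -1
    · simp [hj, residue_apply]
    · simp [hj]
  rw [residue_apply, hc]
  refine ((HahnSeries.coeff.addMonoidHom (Γ := ℤ) (R := k) (-1)).map_finsum hfin).trans ?_
  refine (finsum_congr hres).trans ?_
  rw [finsum_eq_single _ (-1) fun j hj => if_neg hj, if_pos rfl]

end Sums

end FormalResidue

end

theorem theorem3p2 {k : Type*} [Field k] (f g : k⸨X⸩⟦X⟧)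
    (hfg : FormalResidue.IsChangeOfVariables f g) (ω : FormalResidue.TwoForm k) :
    (∃! η : FormalResidue.TwoForm k, ω.IsPullback f g η) ∧
      ∀ η : FormalResidue.TwoForm k, ω.IsPullback f g η → η.twoResidue = ω.twoResidue := by
  have hf : ∀ t < 1, (PowerSeries.constantCoeff f).coeff t = 0 := by
    obtain ⟨p, hp, hp1, -⟩ := hfg.f_mem
    intro t ht
    rw [← hp]
    rcases lt_or_ge t 0 with h0 | h0
    · exact FormalResidue.coe_coeff_of_neg p h0
    · obtain rfl : t = ((0 : ℕ) : ℤ) := by omega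
      rw [HahnSeries.ofPowerSeries_apply_coeff]
      rw [PowerSeries.coeff_zero_eq_constantCoeff_apply]
      exact PowerSeries.X_dvd_iff.1 hp1
  refine ⟨?_, ?_⟩
  · obtain ⟨H, hH⟩ := FormalResidue.exists_hasSubst hf hfg.g_mem.1 ω.fn
    refine ⟨⟨H * FormalResidue.jacobian (f : FormalResidue.Iter k) (g : FormalResidue.Iter k)⟩,
      ⟨H, hH, rfl⟩, ?_⟩
    rintro η ⟨H', hH', hη⟩
    exact FormalResidue.TwoForm.ext (by rw [hη, hH'.unique hH])
  · rintro η ⟨H, hH, hη⟩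
    have h := hH.residue_mul_jac hfg
    change FormalResidue.residue k η.fn = FormalResidue.residue k ω.fn
    rw [hη]
    exact h
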